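/- Let a binary classifier on $\mathbb{R}^d$ be identified with its positive region $h\subseteq\mathbb{R}^d$ (so $h(x)=1$ iff $x\in h$). Let $\alpha\ge 0$ and let $c(x,x')=\|x-x'\|_p$ with $p\in\{1,2,\infty\}$. Let $\Delta_h(x)\in\operatorname{argmax}_{x'\in\mathbb{R}^d}\bigl(\alpha\,h(x')-c(x,x')\bigr)$ be the best response of $x$ to $h$, where ties are broken in favour of points with $h(x')=1$; let $h_\Delta(x)=h(\Delta_h(x))$ be the effective classifier and, for a class $H$ of classifiers, let $H_\Delta=\{h_\Delta : h\in H\}$ be the effective class. Let $P^k$ be the class of classifiers on $\mathbb{R}^d$ whose positive region is a $k$-vertex polytope, that is, the convex hull of a nonempty set of at most $k$ points (so polytopes with exactly $k$ vertices are included). Theorem. There is an absolute constant $C>0$ such that for all integers $d\ge 0$ and $k\ge 2$, all $p\in\{1,2,\infty\}$, all $\alpha\ge 0$, and every class $H\subseteq P^k$, $$\mathrm{VC}(H_\Delta)\le C\,k\,d^2\log k .$$ In particular $\mathrm{VC}(H_\Delta)$ is finite. -/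

import Mathlib

namespace StrategicClassification

/-! A binary classifier `h : X → {0, 1}` is represented by its positive region `h : Set X`,
so that `h(x) = 1` iff `x ∈ h`; a model class is a set of classifiers. -/

/-- The utility `α · h(x') - c(x, x')` of a user with features `x` who reports `x'`. -/
noncomputable def utility {X : Type*} (α : ℝ) (c : X → X → ℝ) (h : Set X) (x x' : X) : ℝ :=
  α * h.indicator (fun _ => (1 : ℝ)) x' - c x x'

/-- `x'` belongs to `argmax_{x'} (α h(x') - c(x, x'))`. -/
def IsMaximizer {X : Type*} (α : ℝ) (c : X → X → ℝ) (h : Set X) (x x' : X) : Prop :=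
  ∀ z : X, utility α c h x z ≤ utility α c h x x'

/-- `x'` is a best response of `x`: a maximizer of the utility which is classified as positive
whenever some maximizer is. -/
def IsBestResponse {X : Type*} (α : ℝ) (c : X → X → ℝ) (h : Set X) (x x' : X) : Prop :=
  IsMaximizer α c h x x' ∧ ((∃ z : X, IsMaximizer α c h x z ∧ z ∈ h) → x' ∈ h)

open Classical in
/-- The best-response mapping `Δ_h`. Whether `Δ_h(x) ∈ h` does not depend on which best response
is chosen. (If the utility has no maximizer, `x` does not move; this never
happens for a compact positive region and a norm cost.) -/
noncomputable def bestResponse {X : Type*} (α : ℝ) (c : X → X → ℝ) (h : Set X) (x : X) : X :=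
  if hx : ∃ x' : X, IsBestResponse α c h x x' then hx.choose else x

/-- The effective classifier `h_Δ(x) = h(Δ_h(x))`. -/
def effectiveClassifier {X : Type*} (α : ℝ) (c : X → X → ℝ) (h : Set X) : Set X :=
  {x | bestResponse α c h x ∈ h}

/-- The effective class `H_Δ = {h_Δ : h ∈ H}`. -/
def effectiveClass {X : Type*} (α : ℝ) (c : X → X → ℝ) (H : Set (Set X)) : Set (Set X) :=
  {g | ∃ h ∈ H, g = effectiveClassifier α c h}

/-- The class `H` shatters the finite set `S`: it realizes every labelling of `S`. -/
def ClassShatters {X : Type*} (H : Set (Set X)) (S : Finset X) : Prop :=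
  ∀ T : Set X, T ⊆ (S : Set X) → ∃ h ∈ H, (S : Set X) ∩ h = T

/-- The VC dimension of `H`: the supremum of the sizes of the finite sets that `H` shatters. -/
noncomputable def classVCDim {X : Type*} (H : Set (Set X)) : ℕ∞ :=
  ⨆ (S : Finset X) (_ : ClassShatters H S), (S.card : ℕ∞)

/-- The `ℓ_p` cost `c(x, x') = ‖x - x'‖_p` on `ℝ^d`. -/
noncomputable def lpCost (p : ENNReal) {d : ℕ} (x x' : Fin d → ℝ) : ℝ :=
  ‖WithLp.toLp p (x - x')‖

/-- The class `P^k` of (positive-inside) `k`-vertex polytopes in `ℝ^d`: nonempty convex hulls of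
at most `k` points, of any affine dimension. The polytopes with exactly `k` vertices are among
them. -/
def vertexPolytopes (d k : ℕ) : Set (Set (Fin d → ℝ)) :=
  {P | ∃ V : Finset (Fin d → ℝ), V.Nonempty ∧ V.card ≤ k ∧ P = convexHull ℝ (V : Set (Fin d → ℝ))}

end StrategicClassification

/-! A norm cost attains its minimum on a compact polytope `P`, so the effective positive region of
`P` is its closed `α`-neighbourhood. Listing the vertices, with repetitions, parametrizes all these
regions by `v ∈ ℝ^(k × d)`. The proof bounds the algebraic complexity in `v` of the condition "`x`
is within `α` of the hull", for a fixed point `x`, and then counts sign patterns.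

Complexity. By Carathéodory's theorem only subfamilies of at most `d + 1` vertices matter. For the
norms with `p = 1, ∞`, closeness to such a simplex is the feasibility of a linear system with `O(d)`
constraints; a feasible system has a basic solution, which Cramer's rule expresses by polynomials in
`v` (`exists_mulVec_le_iff`). For `p = 2` the nearest point is the projection to the affine span of
an affinely independent subfamily, again given by Cramer's rule
(`exists_mem_convexHull_dotProduct_le_iff`). For `d ≥ 1`, the condition is thus decided by the signs
of `k^O(d)` polynomials of degree `O(d)`.

Counting. A weak form of Warren's theorem (`card_le_of_strict_sign_patterns`) bounds the number of
sign patterns of `N` polynomials of degree at most `D` in `r` variables by `(N D + 3)^r`. Each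
bounded sign cell contains a critical point of one perturbed polynomial, and the critical points are
counted by linear algebra. Shattering `n` points needs `2^n` patterns with `r = k d`, so `n ≤ k d
(log₂ n + O(d log k))`, which gives `n = O(k d² log k)`. -/

section Polynomials

open MvPolynomial

/-! ### Counting sign patterns of polynomials. -/

/-- A finite set on which `x_i ^ e` agrees with a polynomial of total degree less than `e`, for
every coordinate `i`, has at most `e ^ card σ` points. -/
theorem card_le_pow_of_pow_eq_eval {σ : Type*} [Fintype σ] [DecidableEq σ] (Z : Finset (σ → ℝ))
    (e : ℕ) (g : σ → MvPolynomial σ ℝ) (hg : ∀ i, (g i).totalDegree < e)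
    (hZ : ∀ z ∈ Z, ∀ i, z i ^ e = eval z (g i)) : Z.card ≤ e ^ Fintype.card σ := by
  classical
  set mono : (σ → Fin e) → (Z → ℝ) := fun a z => ∏ i, z.1 i ^ (a i : ℕ) with hmono
  set S := Submodule.span ℝ (Set.range mono) with hS
  have lin : ∀ (q : MvPolynomial σ ℝ), (∀ a ∈ q.support, (fun z : Z => ∏ i, z.1 i ^ a i) ∈ S) →
      (fun z : Z => eval z.1 q) ∈ S := by
    intro q hq
    have : (fun z : Z => eval z.1 q)
        = ∑ a ∈ q.support, q.coeff a • (fun z : Z => ∏ i, z.1 i ^ a i) := by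
      ext z
      simp [eval_eq']
    rw [this]
    exact Submodule.sum_mem _ fun a ha => Submodule.smul_mem _ _ (hq a ha)
  -- Every monomial reduces on `Z` to monomials with all exponents below `e`: replacing a factor
  -- `x_i ^ e` by `g i` strictly lowers the total degree.
  have key : ∀ (n : ℕ) (a : σ →₀ ℕ), (∑ i, a i) = n →
      (fun z : Z => ∏ i, z.1 i ^ a i) ∈ S := by
    intro n
    induction n using Nat.strong_induction_on with
    | _ n ih =>
      intro a ha
      by_cases h : ∀ i, a i < e
      · exact Submodule.subset_span ⟨fun i => ⟨a i, h i⟩, rfl⟩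
      · push Not at h
        obtain ⟨i, hi⟩ := h
        set b : σ →₀ ℕ := a - Finsupp.single i e with hb
        have hab : a = b + Finsupp.single i e := by
          ext j
          by_cases hj : j = i
          · subst hj; simp [hb]; omega
          · simp [hb, Ne.symm hj]
        have hsum : ∑ j, a j = ∑ j, b j + e := by
          rw [hab]
          simp [Finset.sum_add_distrib, Finsupp.single_apply]
        have hfun : (fun z : Z => ∏ j, z.1 j ^ a j)
            = fun z : Z => eval z.1 (monomial b 1 * g i) := by
          ext z
          have hprod : ∏ j, z.1 j ^ (Finsupp.single i e j) = z.1 i ^ e := by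
            rw [Finset.prod_eq_single i (fun j _ hj => by simp [Ne.symm hj]) (by simp)]
            simp
          rw [map_mul, ← hZ z.1 z.2 i, hab, eval_monomial, Finsupp.prod_fintype _ _ (by simp)]
          simp only [Finsupp.add_apply, pow_add, Finset.prod_mul_distrib, one_mul, hprod]
        rw [hfun]
        apply lin
        intro c hc
        have hdeg : ∑ j, c j ≤ (monomial b (1 : ℝ) * g i).totalDegree := by
          have := le_totalDegree hc
          rwa [Finsupp.sum_fintype _ _ (by simp)] at this
        have h1 := totalDegree_mul (monomial b (1 : ℝ)) (g i)
        have h2 : (monomial b (1 : ℝ)).totalDegree = ∑ j, b j := by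
          rw [totalDegree_monomial _ one_ne_zero, Finsupp.sum_fintype _ _ (by simp)]
        have h3 := hg i
        exact ih (∑ j, c j) (by omega) c rfl
  have hpoly : ∀ q : MvPolynomial σ ℝ, (fun z : Z => eval z.1 q) ∈ S := fun q =>
    lin q fun a _ => key _ a rfl
  have htop : S = ⊤ := by
    rw [eq_top_iff]
    intro φ _
    have hsep : ∀ z w : Z, ∃ l : MvPolynomial σ ℝ, eval w.1 l = 0 ∧ (z ≠ w → eval z.1 l ≠ 0) := by
      intro z w
      by_cases hzw : z = w
      · exact ⟨0, by simp, fun h => absurd hzw h⟩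
      · obtain ⟨i, hi⟩ : ∃ i, z.1 i ≠ w.1 i := by
          by_contra! h
          exact hzw (Subtype.ext (funext h))
        exact ⟨X i - C (w.1 i), by simp, fun _ => by simpa [sub_eq_zero] using hi⟩
    choose l hl0 hl1 using hsep
    -- Lagrange interpolation from the separating linear forms: every function on `Z` is polynomial,
    -- so the `e ^ card σ` reduced monomials span a space of dimension `Z.card`.
    set q : Z → MvPolynomial σ ℝ := fun z => ∏ w ∈ Finset.univ.erase z, l z w with hq
    have hq0 : ∀ z, eval z.1 (q z) ≠ 0 := by
      intro z
      simp only [hq, map_prod]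
      exact Finset.prod_ne_zero_iff.2 fun w hw => hl1 z w (Finset.ne_of_mem_erase hw).symm
    have hq1 : ∀ z w, w ≠ z → eval w.1 (q z) = 0 := by
      intro z w hwz
      simp only [hq, map_prod]
      exact Finset.prod_eq_zero (Finset.mem_erase.2 ⟨hwz, Finset.mem_univ w⟩) (hl0 z w)
    have : φ = fun w : Z => eval w.1 (∑ z : Z, C (φ z / eval z.1 (q z)) * q z) := by
      ext w
      simp only [map_sum, map_mul, eval_C]
      rw [Finset.sum_eq_single w (fun z _ hz => by rw [hq1 z w hz.symm, mul_zero]) (by simp),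
        div_mul_cancel₀ _ (hq0 w)]
    rw [this]
    exact hpoly _
  have h1 := finrank_range_le_card (R := ℝ) mono
  rw [Set.finrank, ← hS, htop, finrank_top] at h1
  simpa using h1

theorem hasDerivAt_eval_update {σ : Type*} [DecidableEq σ] (p : MvPolynomial σ ℝ) (z : σ → ℝ)
    (i : σ) (t : ℝ) :
    HasDerivAt (fun t => eval (Function.update z i t) p)
      (eval (Function.update z i t) (pderiv i p)) t := by
  induction p using MvPolynomial.induction_on with
  | C a => simpa using hasDerivAt_const t a
  | add p q hp hq =>
    simp only [map_add]
    exact hp.add hq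
  | mul_X p j hp =>
    have hX : HasDerivAt (fun t => Function.update z i t j)
        (eval (Function.update z i t) (pderiv i (X j : MvPolynomial σ ℝ))) t := by
      by_cases h : j = i
      · subst h
        simp only [Function.update_self, pderiv_X_self, map_one]
        exact hasDerivAt_id t
      · simpa [pderiv_X_of_ne h, Function.update_of_ne h] using hasDerivAt_const t (z j)
    simp only [map_mul, eval_X, Derivation.leibniz, smul_eq_mul, map_add]
    refine (hp.mul hX).congr_deriv ?_
    ring

theorem IsLocalExtr.eval_pderiv_eq_zero {σ : Type*} [DecidableEq σ]
    {p : MvPolynomial σ ℝ} {z : σ → ℝ} (h : IsLocalExtr (fun x => eval x p) z) (i : σ) :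
    eval z (pderiv i p) = 0 := by
  have hc : Filter.Tendsto (fun t => Function.update z i t) (nhds (z i)) (nhds z) := by
    have : Continuous (fun t => Function.update z i t) := continuous_const.update i continuous_id
    simpa using this.tendsto (z i)
  have h' : IsLocalExtr (fun t => eval (Function.update z i t) p) (z i) := by
    rcases h with h | h
    · left
      have := hc.eventually h
      simpa [IsLocalMin, IsMinFilter] using this
    · right
      have := hc.eventually h
      simpa [IsLocalMax, IsMaxFilter] using this
  simpa using h'.hasDerivAt_eq_zero (hasDerivAt_eval_update p z i (z i))

theorem totalDegree_pderiv_le {σ : Type*} (p : MvPolynomial σ ℝ) (i : σ) :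
    (pderiv i p).totalDegree ≤ p.totalDegree := by
  conv_lhs => rw [p.as_sum, map_sum]
  refine totalDegree_finsetSum_le fun s hs => ?_
  rw [pderiv_monomial]
  refine (totalDegree_monomial_le _ _).trans (le_trans ?_ (le_totalDegree hs))
  exact Finsupp.degree_mono tsub_le_self

/-- If `F` does not vanish on a nonempty open set `U` with compact closure in `K`, but vanishes on
`K \ U`, then every small perturbation of `F` has a local extremum in `U`. -/
theorem exists_isLocalExtr_of_perturbation {X : Type*} [TopologicalSpace X] {F P : X → ℝ}
    (hF : Continuous F) (hP : Continuous P) {U K : Set X} (hU : IsOpen U) (hK : IsCompact K)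
    (hUK : U ⊆ K) (h0 : ∀ x ∈ K, x ∉ U → F x = 0) {w : X} (hw : w ∈ U)
    (hPw : ∀ x ∈ K, 2 * |P x| < |F w|) :
    ∃ z ∈ U, IsLocalExtr (fun x => F x + P x) z := by
  wlog hpos : 0 ≤ F w generalizing F P with H
  · obtain ⟨z, hz, he⟩ := H hF.neg hP.neg (fun x hx hxU => by simp [h0 x hx hxU])
      (by simpa using hPw) (by simp; linarith)
    refine ⟨z, hz, ?_⟩
    have := he.neg
    simpa [add_comm] using this
  rw [abs_of_nonneg hpos] at hPw
  obtain ⟨z, hzK, hz⟩ := hK.exists_isMaxOn ⟨w, hUK hw⟩ (hF.add hP).continuousOn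
  -- Outside `U` the value is `P z < F w / 2`, while at `w` it exceeds `F w / 2`.
  have hzU : z ∈ U := by
    by_contra hzU
    have h1 := hz (hUK hw)
    simp only [Set.mem_ofPred_eq, Pi.add_apply, h0 z hzK hzU] at h1
    have h2 := hPw z hzK
    have h3 := hPw w (hUK hw)
    have h4 := le_abs_self (P z)
    have h5 := neg_abs_le (P w)
    linarith
  exact ⟨z, hzU, Or.inr ((hz.on_subset hUK).isLocalMax (hU.mem_nhds hzU))⟩

/-- A weak form of Warren's theorem: a bound on the number of sign patterns of a family of
polynomials realized at points where none of them vanishes. -/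
theorem card_le_of_strict_sign_patterns {σ J : Type*} [Fintype σ] [Fintype J]
    (f : J → MvPolynomial σ ℝ) (W : Finset (σ → ℝ)) (h0 : ∀ w ∈ W, ∀ j, eval w (f j) ≠ 0)
    (hW : ∀ w ∈ W, ∀ w' ∈ W, w ≠ w' → ∃ j, eval w (f j) * eval w' (f j) < 0) :
    W.card ≤ (∑ j, (f j).totalDegree + 3) ^ Fintype.card σ := by
  classical
  set N : (σ → ℝ) → ℝ := fun x => ∑ i, x i ^ 2 with hN
  have hNc : Continuous N := by fun_prop
  obtain ⟨R, hR⟩ : ∃ R : ℝ, ∀ w ∈ W, N w < R := by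
    obtain ⟨R, hR⟩ := (W.image N).bddAbove
    exact ⟨R + 1, fun w hw => lt_of_le_of_lt (hR (by simpa using ⟨w, hw, rfl⟩)) (lt_add_one R)⟩
  -- The factor `R - |x|²` makes the cells bounded; `F` vanishes on the part of each closed cell `K
  -- w` outside the open cell `U w`.
  set F : MvPolynomial σ ℝ := (∏ j, f j) * (C R - ∑ i, X i ^ 2) with hFdef
  have hFe : ∀ x, eval x F = (∏ j, eval x (f j)) * (R - N x) := by
    intro x; simp [hFdef, hN]
  set D := ∑ j, (f j).totalDegree with hD
  have hFdeg : F.totalDegree ≤ D + 2 := by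
    refine (totalDegree_mul _ _).trans (add_le_add (totalDegree_finsetProd _ _) ?_)
    refine (totalDegree_sub _ _).trans (max_le (by simp) ?_)
    refine totalDegree_finsetSum_le fun i _ => ?_
    exact (totalDegree_pow _ _).trans (by simp)
  -- At a critical point of `F + δ ∑ x_i ^ (e + 1)` the power `x_i ^ e` is a multiple of `∂_i F`,
  -- whose degree is at most `D + 2 < e`.
  set e := D + 3 with he
  set S : MvPolynomial σ ℝ := ∑ i, X i ^ (e + 1) with hS
  set K : (σ → ℝ) → Set (σ → ℝ) := fun w =>
    {x | N x ≤ R ∧ ∀ j, 0 ≤ eval x (f j) * eval w (f j)} with hK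
  set U : (σ → ℝ) → Set (σ → ℝ) := fun w =>
    {x | N x < R ∧ ∀ j, 0 < eval x (f j) * eval w (f j)} with hU
  have hball : IsCompact {x : σ → ℝ | N x ≤ R} := by
    refine Metric.isCompact_of_isClosed_isBounded (isClosed_le hNc continuous_const) ?_
    refine (Metric.isBounded_closedBall (x := (0 : σ → ℝ)) (r := Real.sqrt R)).subset ?_
    intro x hx
    rw [mem_closedBall_zero_iff, pi_norm_le_iff_of_nonneg (Real.sqrt_nonneg _)]
    intro i
    refine Real.abs_le_sqrt ((Finset.single_le_sum (f := fun i => x i ^ 2)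
      (fun i _ => sq_nonneg _) (Finset.mem_univ i)).trans hx)
  have hKc : ∀ w, IsCompact (K w) := by
    intro w
    have : K w = {x | N x ≤ R} ∩ ⋂ j, {x | 0 ≤ eval x (f j) * eval w (f j)} := by
      ext x; simp [hK]
    rw [this]
    exact hball.inter_right (isClosed_iInter fun j =>
      isClosed_le continuous_const ((continuous_eval _).mul continuous_const))
  have hUo : ∀ w, IsOpen (U w) := by
    intro w
    have : U w = {x | N x < R} ∩ ⋂ j, {x | 0 < eval x (f j) * eval w (f j)} := by
      ext x; simp [hU]
    rw [this]
    exact (isOpen_lt hNc continuous_const).inter (isOpen_iInter_of_finite fun j =>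
      isOpen_lt continuous_const ((continuous_eval _).mul continuous_const))
  have hUK : ∀ w, U w ⊆ K w := fun w x hx => ⟨hx.1.le, fun j => (hx.2 j).le⟩
  have hwU : ∀ w ∈ W, w ∈ U w := fun w hw => ⟨hR w hw, fun j => mul_self_pos.2 (h0 w hw j)⟩
  have hvan : ∀ w ∈ W, ∀ x ∈ K w, x ∉ U w → eval x F = 0 := by
    intro w hw x hx hxU
    rw [hFe]
    by_cases h1 : N x = R
    · simp [h1]
    · have h2 : ∃ j, ¬ 0 < eval x (f j) * eval w (f j) := by
        by_contra! h
        exact hxU ⟨lt_of_le_of_ne hx.1 h1, h⟩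
      obtain ⟨j, hj⟩ := h2
      have h3 : eval x (f j) * eval w (f j) = 0 := le_antisymm (not_lt.1 hj) (hx.2 j)
      have h4 : eval x (f j) = 0 := (mul_eq_zero.1 h3).resolve_right (h0 w hw j)
      rw [Finset.prod_eq_zero (Finset.mem_univ j) h4, zero_mul]
  have hFw : ∀ w ∈ W, 0 < |eval w F| := by
    intro w hw
    rw [abs_pos, hFe]
    exact mul_ne_zero (Finset.prod_ne_zero_iff.2 fun j _ => h0 w hw j)
      (sub_pos.2 (hR w hw)).ne'
  obtain ⟨B, hB⟩ := hball.exists_bound_of_continuousOn (continuous_eval S).continuousOn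
  obtain ⟨m, hm0, hm⟩ : ∃ m : ℝ, 0 < m ∧ ∀ w ∈ W, m ≤ |eval w F| := by
    rcases W.eq_empty_or_nonempty with rfl | hne
    · exact ⟨1, one_pos, by simp⟩
    · obtain ⟨w, hw, h⟩ := W.exists_min_image (fun w => |eval w F|) hne
      exact ⟨_, hFw w hw, h⟩
  set δ : ℝ := m / (2 * (|B| + 1)) with hδ
  have hδ0 : 0 < δ := by positivity
  have hδB : 2 * (δ * |B|) < m := by
    have : δ * (2 * (|B| + 1)) = m := by rw [hδ]; field_simp
    nlinarith
  have hex : ∀ w ∈ W, ∃ z ∈ U w, IsLocalExtr (fun x => eval x (F + C δ * S)) z := by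
    intro w hw
    have := exists_isLocalExtr_of_perturbation (F := fun x => eval x F)
      (P := fun x => eval x (C δ * S)) (continuous_eval F) (continuous_eval _) (hUo w) (hKc w)
      (hUK w) (hvan w hw) (hwU w hw) ?_
    · simpa using this
    · intro x hx
      have h1 : |eval x S| ≤ |B| := (hB x hx.1).trans (le_abs_self B)
      have h2 : |eval x (C δ * S)| ≤ δ * |B| := by
        rw [map_mul, eval_C, abs_mul, abs_of_pos hδ0]
        exact mul_le_mul_of_nonneg_left h1 hδ0.le
      have := hm w hw
      linarith
  choose! z hzU hzE using hex
  have hinj : Set.InjOn z W := by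
    intro w hw w' hw' h
    by_contra hne
    obtain ⟨j, hj⟩ := hW w hw w' hw' hne
    have h1 := (hzU w hw).2 j
    have h2 := (hzU w' hw').2 j
    rw [← h] at h2
    nlinarith [mul_pos h1 h2, sq_nonneg (eval (z w) (f j))]
  rw [← Finset.card_image_of_injOn hinj]
  refine card_le_pow_of_pow_eq_eval _ e (fun i => C (-(1 / (δ * (e + 1)))) * pderiv i F) ?_ ?_
  · intro i
    refine lt_of_le_of_lt (totalDegree_mul _ _) ?_
    have := totalDegree_pderiv_le F i
    simp only [totalDegree_C]
    omega
  · intro y hy i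
    obtain ⟨w, hw, rfl⟩ := Finset.mem_image.1 hy
    have h := (hzE w hw).eval_pderiv_eq_zero i
    have hS' : eval (z w) (pderiv i S) = (e + 1) * z w i ^ e := by
      rw [hS, map_sum, map_sum, Finset.sum_eq_single i]
      · simp
      · intro j _ hj
        simp [pderiv_X_of_ne hj]
      · simp
    rw [map_add, map_add, pderiv_C_mul, map_mul (eval (z w)) (C δ), eval_C, hS'] at h
    rw [map_mul (eval (z w)) (C _), eval_C, eq_neg_of_add_eq_zero_left h]
    have : (0 : ℝ) < δ * (e + 1) := by positivity
    field_simp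

/-- A bound on the number of patterns of weak inequalities. -/
theorem card_le_of_nonneg_patterns {σ J : Type*} [Fintype σ] [Fintype J]
    (f : J → MvPolynomial σ ℝ) (D : ℕ) (hD : ∀ j, (f j).totalDegree ≤ D) (W : Finset (σ → ℝ))
    (hW : ∀ w ∈ W, ∀ w' ∈ W, (∀ j, 0 ≤ eval w (f j) ↔ 0 ≤ eval w' (f j)) → w = w') :
    W.card ≤ (Fintype.card J * D + 3) ^ Fintype.card σ := by
  classical
  -- Adding a small `ε` makes nonnegative values positive and keeps the finitely many negative ones
  -- negative, which reduces weak patterns to strict ones.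
  obtain ⟨ε, hε0, hε⟩ : ∃ ε : ℝ, 0 < ε ∧ ∀ w ∈ W, ∀ j, eval w (f j) < 0 → eval w (f j) + ε < 0 := by
    have : ∀ᶠ ε in nhdsWithin (0 : ℝ) (Set.Ioi 0),
        ∀ w ∈ W, ∀ j, eval w (f j) < 0 → eval w (f j) + ε < 0 := by
      rw [Filter.eventually_all_finset]
      intro w _
      rw [Filter.eventually_all]
      intro j
      by_cases h : eval w (f j) < 0
      · have : ∀ᶠ ε in nhds (0 : ℝ), ε < -eval w (f j) := eventually_lt_nhds (by linarith)
        filter_upwards [nhdsWithin_le_nhds this] with ε hε _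
        linarith
      · exact Filter.Eventually.of_forall fun _ h' => absurd h' h
    obtain ⟨ε, h, h0⟩ := (this.and self_mem_nhdsWithin).exists
    exact ⟨ε, h0, h⟩
  have hpos : ∀ w j, 0 ≤ eval w (f j) → 0 < eval w (f j + C ε) := by
    intro w j h
    simp only [map_add, eval_C]
    linarith
  have hneg : ∀ w ∈ W, ∀ j, ¬ 0 ≤ eval w (f j) → eval w (f j + C ε) < 0 := by
    intro w hw j h
    simpa using hε w hw j (not_le.1 h)
  refine (card_le_of_strict_sign_patterns (fun j => f j + C ε) W ?_ ?_).trans ?_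
  · intro w hw j
    by_cases h : 0 ≤ eval w (f j)
    · exact (hpos w j h).ne'
    · exact (hneg w hw j h).ne
  · intro w hw w' hw' hne
    by_contra! hcon
    refine hne (hW w hw w' hw' fun j => ⟨fun h => ?_, fun h => ?_⟩) <;> by_contra h'
    · exact absurd (hcon j) (not_le.2 (mul_neg_of_pos_of_neg (hpos w j h) (hneg w' hw' j h')))
    · exact absurd (hcon j) (not_le.2 (mul_neg_of_neg_of_pos (hneg w hw j h') (hpos w' j h)))
  · refine Nat.pow_le_pow_left ?_ _
    have : ∑ j, (f j + C ε).totalDegree ≤ ∑ _j : J, D :=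
      Finset.sum_le_sum fun j _ => (totalDegree_add _ _).trans (by simpa using hD j)
    simpa using this

/-! ### Polynomial functions and conditions decided by polynomial signs. -/

/-- `f` is a polynomial function of degree at most `D`. -/
def IsPolyFun {σ : Type*} (D : ℕ) (f : (σ → ℝ) → ℝ) : Prop :=
  ∃ p : MvPolynomial σ ℝ, p.totalDegree ≤ D ∧ ∀ v, eval v p = f v

namespace IsPolyFun

variable {σ ι : Type*} {D E : ℕ} {f g : (σ → ℝ) → ℝ}

theorem mono (hf : IsPolyFun D f) (h : D ≤ E) : IsPolyFun E f :=
  let ⟨p, hp, he⟩ := hf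
  ⟨p, hp.trans h, he⟩

theorem const (D : ℕ) (a : ℝ) : IsPolyFun (σ := σ) D fun _ => a :=
  ⟨C a, by simp, by simp⟩

theorem coord (i : σ) : IsPolyFun 1 fun v => v i :=
  ⟨X i, by simp, by simp⟩

theorem add (hf : IsPolyFun D f) (hg : IsPolyFun D g) : IsPolyFun D fun v => f v + g v :=
  let ⟨p, hp, hpe⟩ := hf
  let ⟨q, hq, hqe⟩ := hg
  ⟨p + q, (totalDegree_add _ _).trans (max_le hp hq), by simp [hpe, hqe]⟩

theorem neg (hf : IsPolyFun D f) : IsPolyFun D fun v => -f v :=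
  let ⟨p, hp, hpe⟩ := hf
  ⟨-p, by simpa using hp, by simp [hpe]⟩

theorem sub (hf : IsPolyFun D f) (hg : IsPolyFun D g) : IsPolyFun D fun v => f v - g v := by
  simpa only [sub_eq_add_neg] using hf.add hg.neg

theorem mul (hf : IsPolyFun D f) (hg : IsPolyFun E g) : IsPolyFun (D + E) fun v => f v * g v :=
  let ⟨p, hp, hpe⟩ := hf
  let ⟨q, hq, hqe⟩ := hg
  ⟨p * q, (totalDegree_mul _ _).trans (add_le_add hp hq), by simp [hpe, hqe]⟩

theorem pow (hf : IsPolyFun D f) (n : ℕ) : IsPolyFun (n * D) fun v => f v ^ n :=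
  let ⟨p, hp, hpe⟩ := hf
  ⟨p ^ n, (totalDegree_pow _ _).trans (Nat.mul_le_mul_left _ hp), by simp [hpe]⟩

theorem sum (s : Finset ι) {F : ι → (σ → ℝ) → ℝ} (hF : ∀ i, IsPolyFun D (F i)) :
    IsPolyFun D fun v => ∑ i ∈ s, F i v := by
  choose p hp hpe using hF
  exact ⟨∑ i ∈ s, p i, totalDegree_finsetSum_le fun i _ => hp i, by simp [hpe]⟩

theorem prod (s : Finset ι) {F : ι → (σ → ℝ) → ℝ} (hF : ∀ i, IsPolyFun D (F i)) :
    IsPolyFun (s.card * D) fun v => ∏ i ∈ s, F i v := by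
  choose p hp hpe using hF
  refine ⟨∏ i ∈ s, p i, (totalDegree_finsetProd _ _).trans ?_, by simp [hpe]⟩
  simpa using Finset.sum_le_card_nsmul s _ D fun i _ => hp i

theorem det {n : Type*} [Fintype n] [DecidableEq n] {A : (σ → ℝ) → Matrix n n ℝ}
    (hA : ∀ i j, IsPolyFun D fun v => A v i j) :
    IsPolyFun (Fintype.card n * D) fun v => (A v).det := by
  simp only [Matrix.det_apply']
  refine sum _ fun τ => ?_
  simpa using (const 0 _).mul (prod Finset.univ fun i => hA (τ i) i)

theorem cramer {n : Type*} [Fintype n] [DecidableEq n] {A : (σ → ℝ) → Matrix n n ℝ}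
    {b : (σ → ℝ) → n → ℝ} (hA : ∀ i j, IsPolyFun D fun v => A v i j)
    (hb : ∀ i, IsPolyFun D fun v => b v i) (i : n) :
    IsPolyFun (Fintype.card n * D) fun v => (A v).cramer (b v) i := by
  simp only [Matrix.cramer_apply]
  refine det fun j l => ?_
  by_cases h : l = i
  · subst h; simpa using hb j
  · simpa [Matrix.updateCol_ne h] using hA j l

theorem mulVec {m n : Type*} [Fintype n] {A : (σ → ℝ) → Matrix m n ℝ}
    {b : (σ → ℝ) → n → ℝ} (hA : ∀ i j, IsPolyFun D fun v => A v i j)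
    (hb : ∀ i, IsPolyFun E fun v => b v i) (i : m) :
    IsPolyFun (D + E) fun v => (A v).mulVec (b v) i :=
  sum _ fun j => (hA i j).mul (hb j)

end IsPolyFun

/-- The truth of `Q v` depends only on which of `M` polynomials in `v`, of degree at most `D`, are
nonnegative. -/
def SignDetermined {σ : Type*} (M D : ℕ) (Q : (σ → ℝ) → Prop) : Prop :=
  ∃ F : Finset (MvPolynomial σ ℝ), F.card ≤ M ∧ (∀ p ∈ F, p.totalDegree ≤ D) ∧
    ∀ v v', (∀ p ∈ F, 0 ≤ eval v p ↔ 0 ≤ eval v' p) → (Q v ↔ Q v')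

namespace SignDetermined

variable {σ : Type*} {M M' D D' : ℕ} {Q R : (σ → ℝ) → Prop}

theorem mono (hQ : SignDetermined M D Q) (hM : M ≤ M') (hD : D ≤ D') :
    SignDetermined M' D' Q :=
  let ⟨F, h1, h2, h3⟩ := hQ
  ⟨F, h1.trans hM, fun p hp => (h2 p hp).trans hD, h3⟩

theorem of_nonneg {f : (σ → ℝ) → ℝ} (hf : IsPolyFun D f) :
    SignDetermined 1 D fun v => 0 ≤ f v := by
  obtain ⟨p, hp, he⟩ := hf
  refine ⟨{p}, by simp, by simpa using hp, fun v v' h => ?_⟩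
  simpa [he] using h

theorem of_le {f g : (σ → ℝ) → ℝ} (hf : IsPolyFun D f) (hg : IsPolyFun D g) :
    SignDetermined 1 D fun v => f v ≤ g v := by
  simpa using of_nonneg (hg.sub hf)

theorem not (hQ : SignDetermined M D Q) : SignDetermined M D fun v => ¬ Q v :=
  let ⟨F, h1, h2, h3⟩ := hQ
  ⟨F, h1, h2, fun v v' h => not_congr (h3 v v' h)⟩

/-- Only weak inequalities serve as tests, so nonvanishing is read off as the failure of `0 ≤ -f²`;
this doubles the degree. -/
theorem of_ne_zero {f : (σ → ℝ) → ℝ} (hf : IsPolyFun D f) :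
    SignDetermined 1 (2 * D) fun v => f v ≠ 0 := by
  have := (of_nonneg (hf.pow 2).neg).not
  refine Eq.mp (congrArg _ (funext fun v => propext ?_)) this
  rw [not_le, neg_lt_zero, sq_pos_iff]

theorem and (hQ : SignDetermined M D Q) (hR : SignDetermined M' D R) :
    SignDetermined (M + M') D fun v => Q v ∧ R v := by
  classical
  obtain ⟨F, h1, h2, h3⟩ := hQ
  obtain ⟨G, g1, g2, g3⟩ := hR
  refine ⟨F ∪ G, (Finset.card_union_le _ _).trans (add_le_add h1 g1), ?_, fun v v' h => ?_⟩
  · intro p hp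
    exact (Finset.mem_union.1 hp).elim (h2 p) (g2 p)
  · exact and_congr (h3 v v' fun p hp => h p (Finset.mem_union_left _ hp))
      (g3 v v' fun p hp => h p (Finset.mem_union_right _ hp))

theorem all {ι : Type*} [Fintype ι] {Q : ι → (σ → ℝ) → Prop}
    (hQ : ∀ i, SignDetermined M D (Q i)) :
    SignDetermined (Fintype.card ι * M) D fun v => ∀ i, Q i v := by
  classical
  choose F h1 h2 h3 using hQ
  refine ⟨Finset.univ.biUnion F, Finset.card_biUnion_le_card_mul _ _ _ fun i _ => h1 i, ?_,
    fun v v' h => ?_⟩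
  · intro p hp
    obtain ⟨i, -, hi⟩ := Finset.mem_biUnion.1 hp
    exact h2 i p hi
  · exact forall_congr' fun i => h3 i v v' fun p hp =>
      h p (Finset.mem_biUnion.2 ⟨i, Finset.mem_univ i, hp⟩)

theorem ex {ι : Type*} [Fintype ι] {Q : ι → (σ → ℝ) → Prop}
    (hQ : ∀ i, SignDetermined M D (Q i)) :
    SignDetermined (Fintype.card ι * M) D fun v => ∃ i, Q i v := by
  simpa using (all fun i => (hQ i).not).not

end SignDetermined

/-- A family of subsets of `X` parametrized by `σ → ℝ`, with membership of each point determined by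
the signs of few polynomials of low degree, shatters only small sets. -/
theorem two_pow_card_le_of_signDetermined {X σ : Type*} [Fintype σ] {M D : ℕ}
    {Q : X → (σ → ℝ) → Prop} (hQ : ∀ x, SignDetermined M D (Q x)) (S : Finset X)
    (hS : ∀ T ⊆ S, ∃ v, ∀ x ∈ S, Q x v ↔ x ∈ T) :
    2 ^ S.card ≤ (S.card * M * D + 3) ^ Fintype.card σ := by
  classical
  choose F h1 h2 h3 using hQ
  choose! v hv using hS
  have hinj : Set.InjOn v (S.powerset : Set (Finset X)) := by
    intro T hT T' hT' h
    simp only [Finset.coe_powerset, Set.mem_preimage, Set.mem_powerset_iff, Finset.coe_subset]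
      at hT hT'
    ext x
    constructor <;> intro hx
    · rw [← hv T' hT' x (hT hx), ← h, hv T hT x (hT hx)]; exact hx
    · rw [← hv T hT x (hT' hx), h, hv T' hT' x (hT' hx)]; exact hx
  -- The `2 ^ S.card` chosen parameters have pairwise different patterns on this joint family of
  -- tests.
  set G := S.biUnion F with hG
  have hGc : G.card ≤ S.card * M := Finset.card_biUnion_le_card_mul _ _ _ fun i _ => h1 i
  have := card_le_of_nonneg_patterns (fun p : G => p.1) D ?_ (S.powerset.image v) ?_
  · rw [Finset.card_image_of_injOn hinj, Finset.card_powerset] at this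
    refine this.trans (Nat.pow_le_pow_left ?_ _)
    rw [Fintype.card_coe]
    gcongr
  · rintro ⟨p, hp⟩
    obtain ⟨i, -, hi⟩ := Finset.mem_biUnion.1 hp
    exact h2 i p hi
  · intro w hw w' hw' h
    obtain ⟨T, hT, rfl⟩ := Finset.mem_image.1 hw
    obtain ⟨T', hT', rfl⟩ := Finset.mem_image.1 hw'
    rw [Finset.mem_powerset] at hT hT'
    have hQQ : ∀ x ∈ S, Q x (v T) ↔ Q x (v T') := fun x hx =>
      h3 x _ _ fun p hp => h ⟨p, Finset.mem_biUnion.2 ⟨x, hx, hp⟩⟩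
    have : T = T' := by
      ext x
      constructor <;> intro hx
      · rw [← hv T' hT' x (hT hx), ← hQQ x (hT hx), hv T hT x (hT hx)]; exact hx
      · rw [← hv T hT x (hT' hx), hQQ x (hT' hx), hv T' hT' x (hT' hx)]; exact hx
    rw [this]

end Polynomials

section Hulls

open Matrix

/-! ### Feasibility of linear systems as a polynomial sign condition. -/

/-- A feasible system of linear inequalities has a feasible point at which the constraints that
are active span all the constraints. -/
theorem exists_mulVec_le_active_span {ι κ : Type*} [Fintype ι] [Fintype κ]
    (A : Matrix ι κ ℝ) (b : ι → ℝ) (h : ∃ z, ∀ i, (A *ᵥ z) i ≤ b i) :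
    ∃ z, (∀ i, (A *ᵥ z) i ≤ b i) ∧
      ∀ v, (∀ i, (A *ᵥ z) i = b i → (A *ᵥ v) i = 0) → ∀ i, (A *ᵥ v) i = 0 := by
  classical
  set act : (κ → ℝ) → Finset ι := fun z => Finset.univ.filter fun i => (A *ᵥ z) i = b i with hact
  -- Take a feasible point with the most active constraints. A direction that fixes the active
  -- constraints but changes another one could be followed until a new constraint becomes active.
  obtain ⟨z, hz, hmax⟩ : ∃ z, (∀ i, (A *ᵥ z) i ≤ b i) ∧
      ∀ z', (∀ i, (A *ᵥ z') i ≤ b i) → (act z').card ≤ (act z).card := by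
    set P : ℕ → Prop := fun n => ∃ z, (∀ i, (A *ᵥ z) i ≤ b i) ∧ (act z).card = n
    have hP : ∃ n, P n := let ⟨z, hz⟩ := h; ⟨_, z, hz, rfl⟩
    have hb : ∀ n, P n → n ≤ Fintype.card ι := by
      rintro n ⟨z, -, rfl⟩
      exact Finset.card_le_univ _
    obtain ⟨n, hn⟩ := hP
    obtain ⟨z, hz, hc⟩ := Nat.findGreatest_spec (hb n hn) hn
    exact ⟨z, hz, fun z' hz' => hc ▸ Nat.le_findGreatest (hb _ ⟨z', hz', rfl⟩) ⟨z', hz', rfl⟩⟩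
  have key : ∀ v, (∀ i, (A *ᵥ z) i = b i → (A *ᵥ v) i = 0) → ∀ i, ¬ 0 < (A *ᵥ v) i := by
    intro v hv i hi
    obtain ⟨j, hj, hjmin⟩ := (Finset.univ.filter fun i => 0 < (A *ᵥ v) i).exists_min_image
      (fun i => (b i - (A *ᵥ z) i) / (A *ᵥ v) i) ⟨i, by simpa using hi⟩
    simp only [Finset.mem_filter, Finset.mem_univ, true_and] at hj hjmin
    -- The first time at which a constraint increasing along `v` becomes tight.
    set t := (b j - (A *ᵥ z) j) / (A *ᵥ v) j with ht
    have ht0 : 0 ≤ t := div_nonneg (sub_nonneg.2 (hz j)) hj.le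
    have hA : ∀ l, (A *ᵥ (z + t • v)) l = (A *ᵥ z) l + t * (A *ᵥ v) l := by
      intro l; simp [mulVec_add, mulVec_smul]
    have hfeas : ∀ l, (A *ᵥ (z + t • v)) l ≤ b l := by
      intro l
      rw [hA]
      by_cases hl : 0 < (A *ᵥ v) l
      · have := (le_div_iff₀ hl).1 (hjmin l hl)
        linarith
      · have := mul_nonpos_of_nonneg_of_nonpos ht0 (not_lt.1 hl)
        linarith [hz l]
    have hlt : act z ⊂ act (z + t • v) := by
      refine (Finset.ssubset_iff_of_subset fun l hl => ?_).2 ⟨j, ?_, ?_⟩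
      · simp only [hact, Finset.mem_filter, Finset.mem_univ, true_and] at hl ⊢
        rw [hA, hv l hl, hl, mul_zero, add_zero]
      · simp only [hact, Finset.mem_filter, Finset.mem_univ, true_and]
        rw [hA, ht, div_mul_cancel₀ _ hj.ne']
        ring
      · simp only [hact, Finset.mem_filter, Finset.mem_univ, true_and]
        intro hjz
        exact hj.ne' (hv j hjz)
    exact absurd (hmax _ hfeas) (not_le.2 (Finset.card_lt_card hlt))
  refine ⟨z, hz, fun v hv i => le_antisymm (not_lt.1 (key v hv i)) ?_⟩
  have := key (-v) (fun i hi => by simp [mulVec_neg, hv i hi]) i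
  simpa [mulVec_neg] using this

/-- The Gram matrix of the rows of `A` indexed by `J`. -/
def rowGram {ι κ : Type*} [Fintype κ] (A : Matrix ι κ ℝ) (J : Finset ι) : Matrix J J ℝ :=
  A.submatrix (Subtype.val : J → ι) id * (A.submatrix (Subtype.val : J → ι) id)ᵀ

/-- The minimal norm solution of the equations indexed by `J`, multiplied by `det (rowGram A J)`. -/
def rowSolution {ι κ : Type*} [DecidableEq ι] [Fintype κ] (A : Matrix ι κ ℝ)
    (b : ι → ℝ) (J : Finset ι) : κ → ℝ :=
  (A.submatrix (Subtype.val : J → ι) id)ᵀ *ᵥ (rowGram A J).cramer fun j => b j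

/-- This eliminates the quantifier over `z`. At a feasible point whose active rows span all rows,
let `J` index a basis of the active rows. Any solution of the equations in `J` differs from that
point by a vector which every row annihilates, so it is feasible as well. Multiplying by the squared
Gram determinant clears denominators without affecting the direction of the inequality. -/
theorem exists_mulVec_le_iff {ι κ : Type*} [Fintype ι] [DecidableEq ι] [Fintype κ]
    (A : Matrix ι κ ℝ) (b : ι → ℝ) :
    (∃ z, ∀ i, (A *ᵥ z) i ≤ b i) ↔ ∃ J : Finset ι, (rowGram A J).det ≠ 0 ∧
      ∀ i, (rowGram A J).det * (A *ᵥ rowSolution A b J) i ≤ b i * (rowGram A J).det ^ 2 := by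
  constructor
  · intro h
    obtain ⟨z, hz, hspan⟩ := exists_mulVec_le_active_span A b h
    obtain ⟨s, hs, -, hsp, hli⟩ := exists_linearIndepOn_extension (K := ℝ) (v := A.row)
      (s := ∅) (t := {i | (A *ᵥ z) i = b i}) (linearIndepOn_empty _ _) (Set.empty_subset _)
    classical
    set J : Finset ι := s.toFinset with hJ
    set B := A.submatrix (Subtype.val : J → ι) id with hB
    have hBli : LinearIndependent ℝ B.row := by
      have hcoe : (J : Set ι) = s := by simp [hJ]
      have : LinearIndepOn ℝ A.row (J : Set ι) := hcoe ▸ hli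
      exact this
    have hdet : (rowGram A J).det ≠ 0 := by
      have := Matrix.PosDef.mul_conjTranspose_self B (Matrix.vecMul_injective_iff.2 hBli)
      rw [conjTranspose_eq_transpose_of_trivial] at this
      exact this.det_pos.ne'
    set δ := (rowGram A J).det with hδ
    set z' : κ → ℝ := δ⁻¹ • rowSolution A b J with hz'
    have hsol : ∀ j ∈ J, (A *ᵥ z') j = b j := by
      intro j hj
      have h1 : B *ᵥ rowSolution A b J = δ • fun j : J => b j := by
        rw [rowSolution, mulVec_mulVec, ← hB]
        exact mulVec_cramer _ _
      have h2 := congrFun h1 ⟨j, hj⟩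
      have h3 : (B *ᵥ rowSolution A b J) ⟨j, hj⟩ = (A *ᵥ rowSolution A b J) j := rfl
      rw [h3] at h2
      rw [hz', mulVec_smul, Pi.smul_apply, h2, Pi.smul_apply, smul_smul, inv_mul_cancel₀ hdet,
        one_smul]
    have hv := hspan (z' - z) ?_
    · refine ⟨J, hdet, fun i => ?_⟩
      have h1 := hv i
      rw [mulVec_sub, Pi.sub_apply, sub_eq_zero] at h1
      have h2 : (A *ᵥ rowSolution A b J) i = δ * (A *ᵥ z') i := by
        rw [hz', mulVec_smul, Pi.smul_apply, smul_eq_mul, mul_inv_cancel_left₀ hdet]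
      rw [h2, h1]
      nlinarith [hz i, sq_nonneg δ]
    · intro i hi
      have hmem : A.row i ∈ Submodule.span ℝ (A.row '' s) := hsp ⟨i, hi, rfl⟩
      have : ∀ w ∈ Submodule.span ℝ (A.row '' s), w ⬝ᵥ (z' - z) = 0 := by
        intro w hw
        induction hw using Submodule.span_induction with
        | mem w hw =>
          obtain ⟨j, hj, rfl⟩ := hw
          have h1 : (A *ᵥ (z' - z)) j = 0 := by
            rw [mulVec_sub, Pi.sub_apply, hsol j (by simpa [hJ] using hj), hs hj, sub_self]
          exact h1
        | zero => simp
        | add x y _ _ hx hy => rw [add_dotProduct, hx, hy, add_zero]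
        | smul a x _ hx => rw [smul_dotProduct, hx, smul_zero]
      exact this _ hmem
  · rintro ⟨J, hdet, h⟩
    refine ⟨(rowGram A J).det⁻¹ • rowSolution A b J, fun i => ?_⟩
    have hpos : 0 < (rowGram A J).det ^ 2 := by positivity
    rw [mulVec_smul, Pi.smul_apply, smul_eq_mul, ← mul_le_mul_iff_left₀ hpos]
    refine le_trans (le_of_eq ?_) (h i)
    field_simp

/-- Each of the `2 ^ n` sets `J` (with `n` constraints) costs one nonvanishing test and `n`
inequalities. The Gram determinant has degree at most `2 n` and the scaled solution at most `2 n +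
1`, whence `4 n + 2`. -/
theorem IsPolyFun.exists_mulVec_le {σ ι κ : Type*} [Fintype ι] [Fintype κ]
    {A : (σ → ℝ) → Matrix ι κ ℝ} {b : (σ → ℝ) → ι → ℝ}
    (hA : ∀ i j, IsPolyFun 1 fun v => A v i j) (hb : ∀ i, IsPolyFun 1 fun v => b v i) :
    SignDetermined (2 ^ Fintype.card ι * (1 + Fintype.card ι)) (4 * Fintype.card ι + 2)
      fun v => ∃ z, ∀ i, (A v *ᵥ z) i ≤ b v i := by
  classical
  simp only [exists_mulVec_le_iff]
  rw [← Fintype.card_finset]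
  refine SignDetermined.ex fun J => ?_
  have hJ : Fintype.card J ≤ Fintype.card ι := by
    rw [Fintype.card_coe]; exact Finset.card_le_univ J
  have hG : ∀ i j, IsPolyFun 2 fun v => rowGram (A v) J i j := fun i j =>
    IsPolyFun.sum _ fun l => (hA i l).mul (hA j l)
  have hdet : IsPolyFun (Fintype.card ι * 2) fun v => (rowGram (A v) J).det :=
    (IsPolyFun.det hG).mono (Nat.mul_le_mul_right _ hJ)
  have hsol : ∀ l, IsPolyFun (1 + Fintype.card ι * 2) fun v => rowSolution (A v) (b v) J l :=
    fun l => IsPolyFun.mulVec (A := fun v => ((A v).submatrix (Subtype.val : J → ι) id)ᵀ)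
      (b := fun v => (rowGram (A v) J).cramer fun j => b v j) (fun i j => hA j i) (fun j =>
      (IsPolyFun.cramer hG (fun j => (hb j).mono one_le_two) j).mono
        (Nat.mul_le_mul_right _ hJ)) l
  refine SignDetermined.and ((SignDetermined.of_ne_zero hdet).mono le_rfl (by omega)) ?_
  have : ∀ i, SignDetermined 1 (4 * Fintype.card ι + 2) fun v => (rowGram (A v) J).det *
      (A v *ᵥ rowSolution (A v) (b v) J) i ≤ b v i * (rowGram (A v) J).det ^ 2 := fun i =>
    SignDetermined.of_le ((hdet.mul (IsPolyFun.mulVec hA hsol i)).mono (by omega))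
      (((hb i).mul (hdet.pow 2)).mono (by omega))
  simpa using SignDetermined.all this

/-! ### Distance to a convex hull in a polyhedral norm. -/

/-- Carathéodory's theorem, with the subfamily recorded by an index tuple so that the list of
candidates does not depend on `V`. -/
theorem exists_affineIndependent_of_mem_convexHull {d k : ℕ} (V : Fin k → Fin d → ℝ)
    {y : Fin d → ℝ} (hy : y ∈ convexHull ℝ (Set.range V)) :
    ∃ (m : Fin (d + 2)) (T : Fin m → Fin k) (w : Fin m → ℝ), AffineIndependent ℝ (V ∘ T) ∧
      (∀ i, 0 < w i) ∧ ∑ i, w i = 1 ∧ ∑ i, w i • V (T i) = y := by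
  obtain ⟨ι, _, z, w, hz, hind, hw, hw1, hwy⟩ := eq_pos_convex_span_of_mem_convexHull hy
  have hc : Fintype.card ι < d + 2 := by
    have := hind.card_le_finrank_succ
    have := Submodule.finrank_le (vectorSpan ℝ (Set.range z))
    rw [Module.finrank_fintype_fun_eq_card, Fintype.card_fin] at this
    omega
  set e := Fintype.equivFin ι
  choose T hT using fun i => hz ⟨i, rfl⟩
  have hVT : V ∘ T = z := funext hT
  refine ⟨⟨Fintype.card ι, hc⟩, T ∘ e.symm, w ∘ e.symm, ?_, fun i => hw _, ?_, ?_⟩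
  · rw [← Function.comp_assoc, hVT]
    exact hind.comp_embedding e.symm.toEmbedding
  · rw [← hw1]
    exact Equiv.sum_comp e.symm w
  · rw [← hwy]
    simp only [Function.comp_apply, hT]
    exact Equiv.sum_comp e.symm fun i => w i • z i

theorem sum_smul_mem_convexHull_range {d k m : ℕ} (V : Fin k → Fin d → ℝ) (T : Fin m → Fin k)
    {w : Fin m → ℝ} (hw : ∀ i, 0 ≤ w i) (hw1 : ∑ i, w i = 1) :
    ∑ i, w i • V (T i) ∈ convexHull ℝ (Set.range V) :=
  (convex_convexHull ℝ _).sum_mem (fun i _ => hw i) hw1 fun i _ =>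
    subset_convexHull ℝ _ ⟨T i, rfl⟩

theorem SignDetermined.exists_tuple {σ : Type*} {d k M D : ℕ} (hk : 0 < k)
    {Q : (m : Fin (d + 2)) → (Fin m → Fin k) → (σ → ℝ) → Prop}
    (h : ∀ m T, SignDetermined M D (Q m T)) :
    SignDetermined ((d + 2) * (k ^ (d + 1) * M)) D fun v => ∃ m T, Q m T v := by
  refine (SignDetermined.ex (M := k ^ (d + 1) * M) fun m =>
    (SignDetermined.ex (h m)).mono ?_ le_rfl).mono (by simp) le_rfl
  rw [Fintype.card_fun, Fintype.card_fin, Fintype.card_fin]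
  have : (m : ℕ) ≤ d + 1 := by omega
  gcongr

/-- Constraint matrix, in the variables `(w, s)`, of the system `0 ≤ w`, `∑ w = 1`,
`|x - ∑ w i • u i| ≤ s`, `L s ≤ α`. -/
def hullMatrix {m d : ℕ} (L : Matrix (Fin d) (Fin d) ℝ) (u : Fin m → Fin d → ℝ) :
    Matrix (Fin m ⊕ Unit ⊕ Unit ⊕ Fin d ⊕ Fin d ⊕ Fin d) (Fin m ⊕ Fin d) ℝ
  | .inl i, .inl i' => if i = i' then -1 else 0
  | .inl _, .inr _ => 0
  | .inr (.inl _), .inl _ => 1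
  | .inr (.inl _), .inr _ => 0
  | .inr (.inr (.inl _)), .inl _ => -1
  | .inr (.inr (.inl _)), .inr _ => 0
  | .inr (.inr (.inr (.inl j))), .inl i => u i j
  | .inr (.inr (.inr (.inl j))), .inr j' => if j = j' then -1 else 0
  | .inr (.inr (.inr (.inr (.inl j)))), .inl i => -u i j
  | .inr (.inr (.inr (.inr (.inl j)))), .inr j' => if j = j' then -1 else 0
  | .inr (.inr (.inr (.inr (.inr _)))), .inl _ => 0
  | .inr (.inr (.inr (.inr (.inr j)))), .inr j' => L j j'

/-- Right-hand side of the system with matrix `hullMatrix`. -/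
def hullVector (m : ℕ) {d : ℕ} (α : ℝ) (x : Fin d → ℝ) :
    Fin m ⊕ Unit ⊕ Unit ⊕ Fin d ⊕ Fin d ⊕ Fin d → ℝ
  | .inl _ => 0
  | .inr (.inl _) => 1
  | .inr (.inr (.inl _)) => -1
  | .inr (.inr (.inr (.inl j))) => x j
  | .inr (.inr (.inr (.inr (.inl j)))) => -x j
  | .inr (.inr (.inr (.inr (.inr _)))) => α

/-- The auxiliary variables `s` dominate the absolute coordinates of the residual. They keep the
number of constraints linear in `d` even for the `ℓ_1` ball with its `2 ^ d` facets, which matters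
because that number enters the count of tests exponentially. -/
theorem hullMatrix_mulVec_le_iff {m d : ℕ} (L : Matrix (Fin d) (Fin d) ℝ) (u : Fin m → Fin d → ℝ)
    (α : ℝ) (x : Fin d → ℝ) :
    (∃ z, ∀ i, (hullMatrix L u *ᵥ z) i ≤ hullVector m α x i) ↔
      ∃ w : Fin m → ℝ, (∀ i, 0 ≤ w i) ∧ ∑ i, w i = 1 ∧
        ∃ s : Fin d → ℝ, (∀ j, |(x - ∑ i, w i • u i) j| ≤ s j) ∧ ∀ j, (L *ᵥ s) j ≤ α := by
  have hexp : ∀ z : Fin m ⊕ Fin d → ℝ, (∀ i, (hullMatrix L u *ᵥ z) i ≤ hullVector m α x i) ↔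
      (∀ i, 0 ≤ z (.inl i)) ∧ ∑ i, z (.inl i) = 1 ∧
        (∀ j, |(x - ∑ i, z (.inl i) • u i) j| ≤ z (.inr j)) ∧
          ∀ j, (L *ᵥ fun j => z (.inr j)) j ≤ α := by
    intro z
    simp only [Sum.forall, mulVec, dotProduct, Fintype.sum_sum_type, hullMatrix, hullVector,
      Pi.sub_apply, Finset.sum_apply, Pi.smul_apply, smul_eq_mul, abs_le, ite_mul, neg_mul, one_mul,
      zero_mul, Finset.sum_ite_eq, Finset.mem_univ, if_true, Finset.sum_const_zero, add_zero,
      zero_add, Finset.sum_neg_distrib, neg_le_neg_iff, forall_const, Left.neg_nonpos_iff,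
      mul_comm (z _) (u _ _)]
    constructor
    · rintro ⟨h1, h2, h3, h4, h5, h6⟩
      exact ⟨h1, le_antisymm h2 h3, fun j => ⟨by linarith [h4 j], by linarith [h5 j]⟩, h6⟩
    · rintro ⟨h1, h2, h3, h4⟩
      exact ⟨h1, h2.le, h2.ge, fun j => by linarith [(h3 j).1], fun j => by linarith [(h3 j).2], h4⟩
  simp only [hexp]
  constructor
  · rintro ⟨z, h1, h2, h3, h4⟩
    exact ⟨fun i => z (.inl i), h1, h2, fun j => z (.inr j), h3, h4⟩
  · rintro ⟨w, h1, h2, s, h3, h4⟩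
    exact ⟨Sum.elim w s, by simpa using h1, by simpa using h2, by simpa using h3, by simpa using h4⟩

/-- Being close to the convex hull of `k` points with respect to a polyhedral norm is determined by
the signs of polynomials in the coordinates of these points. -/
theorem signDetermined_polyhedral_convexHull {d k : ℕ} (hk : 0 < k) (α : ℝ) {N : (Fin d → ℝ) → ℝ}
    (L : Matrix (Fin d) (Fin d) ℝ)
    (hL : ∀ y, N y ≤ α ↔ ∃ s : Fin d → ℝ, (∀ j, |y j| ≤ s j) ∧ ∀ j, (L *ᵥ s) j ≤ α)
    (x : Fin d → ℝ) :
    SignDetermined ((d + 2) * (k ^ (d + 1) * (2 ^ (4 * d + 3) * (4 * d + 4)))) (16 * d + 14)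
      fun v : Fin k × Fin d → ℝ =>
        ∃ y ∈ convexHull ℝ (Set.range fun i j => v (i, j)), N (x - y) ≤ α := by
  have heq : ∀ v : Fin k × Fin d → ℝ,
      (∃ y ∈ convexHull ℝ (Set.range fun i j => v (i, j)), N (x - y) ≤ α) ↔
      ∃ m : Fin (d + 2), ∃ T : Fin m → Fin k, ∃ z, ∀ i,
        (hullMatrix L (fun i j => v (T i, j)) *ᵥ z) i ≤ hullVector m α x i := by
    intro v
    simp only [hullMatrix_mulVec_le_iff, ← hL]
    constructor
    · rintro ⟨y, hy, h⟩
      obtain ⟨m, T, w, -, hw, hw1, rfl⟩ := exists_affineIndependent_of_mem_convexHull _ hy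
      exact ⟨m, T, w, fun i => (hw i).le, hw1, h⟩
    · rintro ⟨m, T, w, hw, hw1, h⟩
      exact ⟨_, sum_smul_mem_convexHull_range (fun i j => v (i, j)) T hw hw1, h⟩
  simp only [heq]
  refine SignDetermined.exists_tuple hk fun m T => ?_
  have hm : (m : ℕ) ≤ d + 1 := by omega
  have hc : Fintype.card (Fin m ⊕ Unit ⊕ Unit ⊕ Fin d ⊕ Fin d ⊕ Fin d) ≤ 4 * d + 3 := by
    simp only [Fintype.card_sum, Fintype.card_fin, Fintype.card_unit]
    omega
  refine (IsPolyFun.exists_mulVec_le (A := fun v : Fin k × Fin d → ℝ =>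
    hullMatrix L fun i j => v (T i, j)) (b := fun _ => hullVector m α x) ?_
    fun _ => IsPolyFun.const _ _).mono ?_ (by omega)
  · rintro (i | i | i | i | i | i) (j | j) <;>
      first
      | exact IsPolyFun.const _ _
      | exact IsPolyFun.coord _
      | exact (IsPolyFun.coord _).neg
  · exact Nat.mul_le_mul (Nat.pow_le_pow_right two_pos hc) (by omega)

/-! ### Distance to a convex hull in the Euclidean norm. -/

/-- The bordered Gram matrix of the points `u i`. -/
def borderedGram {m d : ℕ} (u : Fin m → Fin d → ℝ) :
    Matrix (Option (Fin m)) (Option (Fin m)) ℝ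
  | some i, some j => u i ⬝ᵥ u j
  | some _, none => 1
  | none, some _ => 1
  | none, none => 0

/-- The right-hand side of the linear system with matrix `borderedGram u` whose solution contains the
barycentric coordinates of the projection of `x` to the affine span of the points `u i`. -/
def borderedVector {m d : ℕ} (u : Fin m → Fin d → ℝ) (x : Fin d → ℝ) : Option (Fin m) → ℝ
  | some i => u i ⬝ᵥ x
  | none => 1

theorem borderedGram_mulVec_some {m d : ℕ} (u : Fin m → Fin d → ℝ) (w : Option (Fin m) → ℝ)
    (i : Fin m) :
    (borderedGram u *ᵥ w) (some i) = w none + u i ⬝ᵥ ∑ j, w (some j) • u j := by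
  simp only [mulVec, dotProduct_sum, dotProduct_smul]
  simp [dotProduct, Fintype.sum_option, borderedGram, mul_comm]

theorem borderedGram_mulVec_none {m d : ℕ} (u : Fin m → Fin d → ℝ) (w : Option (Fin m) → ℝ) :
    (borderedGram u *ᵥ w) none = ∑ j, w (some j) := by
  simp [mulVec, dotProduct, Fintype.sum_option, borderedGram]

/-- Pairing a kernel vector with its own weights shows that `∑ w_j u_j` has norm zero, so affine
independence kills the weights. The border entry then vanishes by any one row; for `m = 0` the
matrix would be the `1 × 1` zero matrix. -/
theorem det_borderedGram_ne_zero {m d : ℕ} {u : Fin m → Fin d → ℝ} (hm : 0 < m)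
    (hu : AffineIndependent ℝ u) : (borderedGram u).det ≠ 0 := by
  intro h
  obtain ⟨w, hw0, hw⟩ := Matrix.exists_mulVec_eq_zero_iff.2 h
  have hsum : ∑ j, w (some j) = 0 := by
    rw [← borderedGram_mulVec_none, hw, Pi.zero_apply]
  have hrow : ∀ i, w none + u i ⬝ᵥ ∑ j, w (some j) • u j = 0 := fun i => by
    rw [← borderedGram_mulVec_some, hw, Pi.zero_apply]
  have hq : ∑ j, w (some j) • u j = 0 := by
    rw [← dotProduct_self_eq_zero]
    conv_lhs => rw [sum_dotProduct]
    calc ∑ i, (w (some i) • u i) ⬝ᵥ ∑ j, w (some j) • u j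
        = ∑ i, w (some i) * -w none := by
          refine Finset.sum_congr rfl fun i _ => ?_
          rw [smul_dotProduct, smul_eq_mul, eq_neg_of_add_eq_zero_right (hrow i)]
      _ = 0 := by rw [← Finset.sum_mul, hsum, zero_mul]
  have hz := affineIndependent_iff.1 hu Finset.univ (fun j => w (some j)) hsum hq
  refine hw0 (funext fun i => ?_)
  cases i with
  | some i => exact hz i (Finset.mem_univ i)
  | none => simpa [hq] using hrow ⟨0, hm⟩

/-- A nearest point of a compact convex set, and its variational characterization. -/
theorem exists_nearest_of_isCompact_convex {d : ℕ} {K : Set (Fin d → ℝ)} (hK : IsCompact K)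
    (hKc : Convex ℝ K) (hne : K.Nonempty) (x : Fin d → ℝ) :
    ∃ y ∈ K, (∀ z ∈ K, (x - y) ⬝ᵥ (x - y) ≤ (x - z) ⬝ᵥ (x - z)) ∧
      ∀ z ∈ K, (x - y) ⬝ᵥ (z - y) ≤ 0 := by
  obtain ⟨y, hy, hmin⟩ := hK.exists_isMinOn hne
    (f := fun y => (x - y) ⬝ᵥ (x - y)) (by fun_prop)
  refine ⟨y, hy, fun z hz => hmin hz, fun z hz => ?_⟩
  by_contra! ha
  set a := (x - y) ⬝ᵥ (z - y) with hadef
  set b := (z - y) ⬝ᵥ (z - y) with hbdef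
  have hb : 0 ≤ b := Finset.sum_nonneg fun i _ => mul_self_nonneg _
  -- This step size lies in `(0, 1]` without a separate case `b = 0`, and `t b = a - t a` makes `-2
  -- a + t b` negative.
  set t := a / (a + b) with ht
  have hab : 0 < a + b := by linarith
  have ht0 : 0 < t := div_pos ha hab
  have ht1 : t ≤ 1 := (div_le_one hab).2 (by linarith)
  have hmem : y + t • (z - y) ∈ K := by
    have := hKc.add_smul_sub_mem hy hz ⟨ht0.le, ht1⟩
    exact this
  have h1 : (x - y) ⬝ᵥ (x - y) ≤ (x - (y + t • (z - y))) ⬝ᵥ (x - (y + t • (z - y))) := hmin hmem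
  have h2 : (x - (y + t • (z - y))) ⬝ᵥ (x - (y + t • (z - y)))
      = (x - y) ⬝ᵥ (x - y) - 2 * t * a + t ^ 2 * b := by
    rw [← sub_sub, hadef, hbdef]
    generalize x - y = p
    generalize z - y = q
    simp only [sub_dotProduct, dotProduct_sub, smul_dotProduct, dotProduct_smul, smul_eq_mul,
      dotProduct_comm q p]
    ring
  have h3 : t * (a + b) = a := div_mul_cancel₀ _ hab.ne'
  have h4 : 0 ≤ t * (-2 * a + t * b) := by nlinarith
  have h5 : 0 ≤ -2 * a + t * b := nonneg_of_mul_nonneg_right h4 ht0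
  nlinarith

/-- Being close to the convex hull of a family of points in the Euclidean norm, in terms of the
projections to the affine spans of its affinely independent subfamilies. -/
theorem exists_mem_convexHull_dotProduct_le_iff {d k : ℕ} (V : Fin k → Fin d → ℝ)
    (α : ℝ) (x : Fin d → ℝ) :
    (∃ y ∈ convexHull ℝ (Set.range V), (x - y) ⬝ᵥ (x - y) ≤ α ^ 2) ↔
      ∃ (m : Fin (d + 2)) (T : Fin m → Fin k),
        let δ := (borderedGram (V ∘ T)).det
        let c := (borderedGram (V ∘ T)).cramer (borderedVector (V ∘ T) x)
        δ ≠ 0 ∧ (∀ i, 0 ≤ δ * c (some i)) ∧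
          (δ • x - ∑ i, c (some i) • V (T i)) ⬝ᵥ (δ • x - ∑ i, c (some i) • V (T i))
            ≤ α ^ 2 * δ ^ 2 := by
  constructor
  · rintro ⟨y₀, hy₀, hle⟩
    obtain ⟨y, hy, hmin, hvar⟩ := exists_nearest_of_isCompact_convex
      ((Set.finite_range V).isCompact_convexHull (𝕜 := ℝ)) (convex_convexHull ℝ _) ⟨y₀, hy₀⟩ x
    obtain ⟨m, T, w, hind, hw, hw1, hwy⟩ := exists_affineIndependent_of_mem_convexHull _ hy
    have hm : 0 < (m : ℕ) := by
      rcases Nat.eq_zero_or_pos (m : ℕ) with h0 | h0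
      · have : IsEmpty (Fin m) := by rw [h0]; infer_instance
        simp at hw1
      · exact h0
    have hdet := det_borderedGram_ne_zero hm hind
    -- The variational inequality makes every term nonpositive, and their positively weighted sum is
    -- zero. Hence `x - y` is orthogonal to the affine span, and `y` is the projection of `x` to it.
    have hzero : ∀ i, (x - y) ⬝ᵥ (V (T i) - y) = 0 := by
      have h1 : ∀ i ∈ Finset.univ, w i * ((x - y) ⬝ᵥ (V (T i) - y)) ≤ 0 := fun i _ =>
        mul_nonpos_of_nonneg_of_nonpos (hw i).le (hvar _ (subset_convexHull ℝ _ ⟨T i, rfl⟩))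
      have h2 : ∑ i, w i * ((x - y) ⬝ᵥ (V (T i) - y)) = 0 := by
        calc ∑ i, w i * ((x - y) ⬝ᵥ (V (T i) - y))
            = (x - y) ⬝ᵥ (∑ i, w i • V (T i)) - (∑ i, w i) * ((x - y) ⬝ᵥ y) := by
              simp only [dotProduct_sub (x - y), mul_sub, Finset.sum_sub_distrib, Finset.sum_mul,
                dotProduct_sum, dotProduct_smul, smul_eq_mul]
          _ = 0 := by rw [hwy, hw1, one_mul, sub_self]
      intro i
      exact (mul_eq_zero.1 ((Finset.sum_eq_zero_iff_of_nonpos h1).1 h2 i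
        (Finset.mem_univ i))).resolve_left (hw i).ne'
    -- The border entry is the Lagrange multiplier of `∑ w = 1`: the common value of `V (T i) ⬝ᵥ (x
    -- - y)`.
    set W : Option (Fin m) → ℝ := fun o => o.elim ((x - y) ⬝ᵥ y) w with hW
    have hsol : borderedGram (V ∘ T) *ᵥ W = borderedVector (V ∘ T) x := by
      ext o
      cases o with
      | none => rw [borderedGram_mulVec_none]; exact hw1
      | some i =>
        rw [borderedGram_mulVec_some]
        have h1 : ∑ j, W (some j) • (V ∘ T) j = y := hwy
        have h2 := hzero i
        rw [h1]
        simp only [hW, Option.elim, borderedVector, Function.comp_apply]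
        rw [dotProduct_sub, dotProduct_comm _ (V (T i)), dotProduct_sub (V (T i))] at h2
        linarith
    have hc : (borderedGram (V ∘ T)).cramer (borderedVector (V ∘ T) x)
        = (borderedGram (V ∘ T)).det • W := by
      rw [cramer_eq_adjugate_mulVec, ← hsol, mulVec_mulVec, adjugate_mul, smul_mulVec, one_mulVec]
    refine ⟨m, T, hdet, fun i => ?_, ?_⟩
    · rw [hc, Pi.smul_apply, smul_eq_mul, ← mul_assoc]
      exact mul_nonneg (mul_self_nonneg _) (hw i).le
    · set δ := (borderedGram (V ∘ T)).det
      have h1 : δ • x - ∑ i, (δ • W) (some i) • V (T i) = δ • (x - y) := by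
        rw [smul_sub, ← hwy, Finset.smul_sum]
        simp only [Pi.smul_apply, smul_eq_mul, smul_smul, hW, Option.elim]
      rw [hc, h1, smul_dotProduct, dotProduct_smul]
      simp only [smul_eq_mul]
      have h2 := (hmin _ hy₀).trans hle
      nlinarith [sq_nonneg δ]
  -- No optimality is needed here: the border row gives `∑ c = δ`, so `c / δ` are convex weights of
  -- a point close enough to `x`.
  · rintro ⟨m, T, hdet, hpos, hle⟩
    set δ := (borderedGram (V ∘ T)).det
    set c := (borderedGram (V ∘ T)).cramer (borderedVector (V ∘ T) x)
    have hsum : ∑ i, c (some i) = δ := by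
      rw [← borderedGram_mulVec_none, mulVec_cramer]
      simp [borderedVector, δ]
    refine ⟨∑ i, (δ⁻¹ * c (some i)) • V (T i), sum_smul_mem_convexHull_range V T (fun i => ?_) ?_,
      ?_⟩
    · have : δ⁻¹ * c (some i) = (δ * c (some i)) / δ ^ 2 := by field_simp
      rw [this]
      exact div_nonneg (hpos i) (sq_nonneg _)
    · rw [← Finset.mul_sum, hsum, inv_mul_cancel₀ hdet]
    · have h1 : x - ∑ i, (δ⁻¹ * c (some i)) • V (T i)
          = δ⁻¹ • (δ • x - ∑ i, c (some i) • V (T i)) := by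
        rw [smul_sub, smul_smul, inv_mul_cancel₀ hdet, one_smul, Finset.smul_sum]
        simp only [smul_smul]
      have hδ : 0 < δ ^ 2 := by positivity
      rw [h1, smul_dotProduct, dotProduct_smul, ← mul_le_mul_iff_left₀ hδ]
      refine le_trans (le_of_eq ?_) hle
      simp only [smul_eq_mul]
      field_simp

/-- The constants are copied from the polyhedral case so that all three norms share one bound. Each
tuple needs only `m + 2` tests, of degree at most `4 d + 10`. -/
theorem signDetermined_euclidean_convexHull {d k : ℕ} (hk : 0 < k) (α : ℝ) (x : Fin d → ℝ) :
    SignDetermined ((d + 2) * (k ^ (d + 1) * (2 ^ (4 * d + 3) * (4 * d + 4)))) (16 * d + 14)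
      fun v : Fin k × Fin d → ℝ =>
        ∃ y ∈ convexHull ℝ (Set.range fun i j => v (i, j)), (x - y) ⬝ᵥ (x - y) ≤ α ^ 2 := by
  simp only [exists_mem_convexHull_dotProduct_le_iff]
  refine SignDetermined.exists_tuple hk fun m T => ?_
  have hm : (m : ℕ) ≤ d + 1 := by omega
  set u : (Fin k × Fin d → ℝ) → Fin m → Fin d → ℝ := fun v => (fun i j => v (i, j)) ∘ T with hu
  have hupoly : ∀ i j, IsPolyFun 1 fun v => u v i j := fun i j => IsPolyFun.coord (T i, j)
  have hG : ∀ i j, IsPolyFun 2 fun v => borderedGram (u v) i j := by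
    rintro (_ | i) (_ | j)
    · exact IsPolyFun.const _ _
    · exact IsPolyFun.const _ _
    · exact IsPolyFun.const _ _
    · exact IsPolyFun.sum Finset.univ fun l => (hupoly i l).mul (hupoly j l)
  have hb : ∀ i, IsPolyFun 2 fun v => borderedVector (u v) x i := by
    rintro (_ | i)
    · exact IsPolyFun.const _ _
    · exact IsPolyFun.sum Finset.univ fun l => (hupoly i l).mul (IsPolyFun.const 1 (x l))
  have hcard : Fintype.card (Option (Fin m)) * 2 ≤ 2 * d + 4 := by
    rw [Fintype.card_option, Fintype.card_fin]; omega
  have hdet := (IsPolyFun.det hG).mono hcard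
  have hcr := fun i => (IsPolyFun.cramer hG hb i).mono hcard
  have hvec : ∀ j, IsPolyFun (2 * d + 5) fun v => ((borderedGram (u v)).det • x
      - ∑ i, (borderedGram (u v)).cramer (borderedVector (u v) x) (some i) • u v i) j := by
    intro j
    simp only [Pi.sub_apply, Pi.smul_apply, smul_eq_mul, Finset.sum_apply]
    exact (hdet.mul (IsPolyFun.const 1 (x j))).sub
      (IsPolyFun.sum _ fun i => (hcr (some i)).mul (hupoly i j))
  have h1 := (SignDetermined.of_ne_zero hdet).mono (D' := 16 * d + 14) le_rfl (by omega)
  have h2 := (SignDetermined.all fun i : Fin m => SignDetermined.of_nonneg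
    (hdet.mul (hcr (some i)))).mono (D' := 16 * d + 14) le_rfl (by omega)
  have h3 := (SignDetermined.of_le
    ((IsPolyFun.sum Finset.univ fun j => (hvec j).mul (hvec j)).mono (E := 16 * d + 14) (by omega))
    (((IsPolyFun.const 0 (α ^ 2)).mul (hdet.pow 2)).mono (by omega)))
  refine (h1.and (h2.and h3)).mono ?_ le_rfl
  rw [Fintype.card_fin]
  have : 1 ≤ 2 ^ (4 * d + 3) := Nat.one_le_two_pow
  nlinarith

/-! ### Effective classifiers as neighbourhoods, and the final count. -/

namespace StrategicClassification

/-- A point of `h` at cost `c` has utility `α - c`, and no point outside `h` has positive utility.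
Compactness provides a cheapest point of `h`, so a maximizer exists, and the tie-breaking rule
settles the boundary case `c = α`. -/
theorem mem_effectiveClassifier_iff {X : Type*} [TopologicalSpace X] {α : ℝ} (hα : 0 ≤ α)
    {c : X → X → ℝ} (hc0 : ∀ x x', 0 ≤ c x x') (hself : ∀ x, c x x = 0)
    (hcont : ∀ x, Continuous (c x)) {h : Set X} (hh : IsCompact h) (x : X) :
    x ∈ effectiveClassifier α c h ↔ ∃ y ∈ h, c x y ≤ α := by
  classical
  have hin : ∀ y ∈ h, utility α c h x y = α - c x y := fun y hy => by simp [utility, hy]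
  have hout : ∀ y, y ∉ h → utility α c h x y = -c x y := fun y hy => by simp [utility, hy]
  change bestResponse α c h x ∈ h ↔ _
  constructor
  · intro hx
    -- For `x ∉ h` the default value `x` of `bestResponse` cannot lie in `h`, so a genuine best
    -- response exists and is compared with staying at `x`.
    by_cases hxh : x ∈ h
    · exact ⟨x, hxh, by rwa [hself]⟩
    · by_cases hex : ∃ x', IsBestResponse α c h x x'
      · rw [bestResponse, dif_pos hex] at hx
        have h1 := hex.choose_spec.1 x
        rw [hin _ hx, hout x hxh, hself] at h1
        exact ⟨_, hx, by linarith⟩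
      · rw [bestResponse, dif_neg hex] at hx
        exact absurd hx hxh
  · rintro ⟨y, hy, hle⟩
    obtain ⟨y', hy', hmin⟩ := hh.exists_isMinOn ⟨y, hy⟩ (hcont x).continuousOn
    have hmax : IsMaximizer α c h x y' := by
      intro z
      rw [hin y' hy']
      by_cases hz : z ∈ h
      · rw [hin z hz]
        have : c x y' ≤ c x z := hmin hz
        linarith
      · rw [hout z hz]
        have : c x y' ≤ c x y := hmin hy
        linarith [hc0 x z]
    have hex : ∃ x', IsBestResponse α c h x x' := ⟨y', hmax, fun _ => hy'⟩
    rw [bestResponse, dif_pos hex]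
    exact hex.choose_spec.2 ⟨y', hmax, hy'⟩

/-- Padding with copies of one vertex gives every polytope exactly `k` labelled points, hence a
single parameter space. -/
theorem exists_range_eq_of_mem_vertexPolytopes {d k : ℕ} {P : Set (Fin d → ℝ)}
    (hP : P ∈ vertexPolytopes d k) :
    ∃ V : Fin k → Fin d → ℝ, P = convexHull ℝ (Set.range V) := by
  obtain ⟨V, ⟨v₀, hv₀⟩, hk, rfl⟩ := hP
  refine ⟨fun i => if h : (i : ℕ) < V.card then (V.equivFin.symm ⟨i, h⟩ : Fin d → ℝ) else v₀, ?_⟩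
  congr 1
  ext y
  constructor
  · intro hy
    refine ⟨⟨V.equivFin ⟨y, hy⟩, (V.equivFin ⟨y, hy⟩).2.trans_le hk⟩, ?_⟩
    simp
  · rintro ⟨i, rfl⟩
    dsimp only
    split_ifs
    · exact Subtype.property _
    · exact hv₀

theorem mem_effectiveClassifier_lpCost_iff {d k : ℕ} {p : ENNReal} [Fact (1 ≤ p)] {α : ℝ}
    (hα : 0 ≤ α) {P : Set (Fin d → ℝ)} (hP : P ∈ vertexPolytopes d k) (x : Fin d → ℝ) :
    x ∈ effectiveClassifier α (lpCost p) P ↔ ∃ y ∈ P, lpCost p x y ≤ α := by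
  refine mem_effectiveClassifier_iff hα (fun _ _ => norm_nonneg _) (fun x => by simp)
    (fun x => ?_) ?_ x
  · exact ((PiLp.continuous_toLp p _).comp (continuous_const.sub continuous_id)).norm
  · obtain ⟨V, rfl⟩ := exists_range_eq_of_mem_vertexPolytopes hP
    exact (Set.finite_range V).isCompact_convexHull (𝕜 := ℝ)

theorem signDetermined_lpCost_convexHull {d k : ℕ} (hk : 0 < k) {p : ENNReal}
    (hp : p = 1 ∨ p = 2 ∨ p = ⊤) {α : ℝ} (hα : 0 ≤ α) (x : Fin d → ℝ) :
    SignDetermined ((d + 2) * (k ^ (d + 1) * (2 ^ (4 * d + 3) * (4 * d + 4)))) (16 * d + 14)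
      fun v : Fin k × Fin d → ℝ =>
        ∃ y ∈ convexHull ℝ (Set.range fun i j => v (i, j)), lpCost p x y ≤ α := by
  rcases hp with rfl | rfl | rfl
  · refine signDetermined_polyhedral_convexHull hk α (N := fun y => ‖WithLp.toLp 1 y‖)
      -- Every row of the all-ones matrix expresses `∑ s ≤ α`.
      (Matrix.of fun _ _ => 1) (fun y => ?_) x
    have h1 : ‖WithLp.toLp 1 y‖ = ∑ j, |y j| := by
      simp [PiLp.norm_eq_of_L1]
    have h2 : ∀ (s : Fin d → ℝ) j, ((Matrix.of fun _ _ => (1 : ℝ) : Matrix (Fin d) (Fin d) ℝ) *ᵥ s) j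
        = ∑ j, s j := by
      intro s j; simp [mulVec, dotProduct]
    simp only [h1, h2]
    constructor
    · intro h
      exact ⟨fun j => |y j|, fun j => le_rfl, fun _ => h⟩
    · rintro ⟨s, hs, hsum⟩
      -- For `d = 0` there is no row to use, and the claim reduces to `0 ≤ α`.
      rcases isEmpty_or_nonempty (Fin d) with he | ⟨⟨j⟩⟩
      · simpa using hα
      · exact (Finset.sum_le_sum fun j _ => hs j).trans (hsum j)
  · refine (Eq.mp (congrArg _ (funext fun v => propext ?_))
      (signDetermined_euclidean_convexHull hk α x))
    refine exists_congr fun y => and_congr_right fun _ => ?_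
    have h1 : (x - y) ⬝ᵥ (x - y) = lpCost 2 x y ^ 2 := by
      rw [lpCost, EuclideanSpace.norm_sq_eq]
      simp [dotProduct, sq]
    rw [h1]
    exact pow_le_pow_iff_left₀ (norm_nonneg _) hα two_ne_zero
  · refine signDetermined_polyhedral_convexHull hk α (N := fun y => ‖WithLp.toLp ⊤ y‖)
      1 (fun y => ?_) x
    have h1 : ‖WithLp.toLp ⊤ y‖ = ‖y‖ := PiLp.norm_toLp y
    simp only [h1, one_mulVec, pi_norm_le_iff_of_nonneg hα, Real.norm_eq_abs]
    constructor
    · intro h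
      exact ⟨fun j => |y j|, fun j => le_rfl, h⟩
    · rintro ⟨s, hs, hle⟩ j
      exact (hs j).trans (hle j)

theorem two_pow_card_le_of_classShatters {d k : ℕ} (hk : 0 < k) {p : ENNReal}
    (hp : p = 1 ∨ p = 2 ∨ p = ⊤) {α : ℝ} (hα : 0 ≤ α) {H : Set (Set (Fin d → ℝ))}
    (hH : H ⊆ vertexPolytopes d k) {S : Finset (Fin d → ℝ)}
    (hS : ClassShatters (effectiveClass α (lpCost p) H) S) :
    2 ^ S.card ≤ (S.card * ((d + 2) * (k ^ (d + 1) * (2 ^ (4 * d + 3) * (4 * d + 4))))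
      * (16 * d + 14) + 3) ^ (k * d) := by
  have : Fact (1 ≤ p) := ⟨by rcases hp with rfl | rfl | rfl <;> simp⟩
  have := two_pow_card_le_of_signDetermined
    (signDetermined_lpCost_convexHull (d := d) hk hp hα) S ?_
  · simpa using this
  · intro T hT
    obtain ⟨g, ⟨h, hh, rfl⟩, hg⟩ := hS T (by exact_mod_cast hT)
    obtain ⟨V, hV⟩ := exists_range_eq_of_mem_vertexPolytopes (hH hh)
    refine ⟨fun q => V q.1 q.2, fun x hx => ?_⟩
    have h1 := mem_effectiveClassifier_lpCost_iff (p := p) hα (hH hh) x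
    have h2 : x ∈ (S : Set (Fin d → ℝ)) ∩ effectiveClassifier α (lpCost p) h ↔ x ∈ (T : Set _) := by
      rw [hg]
    rw [Set.mem_inter_iff, h1, hV] at h2
    simpa [hx] using h2

/-- After taking logarithms, `n log 2 ≤ A (log n + 20 d log k)` with `A = k d`. The bound on `log n`
is scaled by `4 A` so that it contributes only `n / 4`, which `n log 2 ≥ n / 2` absorbs. This leaves
`n ≤ 96 k d² log k`. -/
theorem card_le_of_two_pow_le {d k n : ℕ} (hk : 2 ≤ k)
    (h : 2 ^ n ≤ (n * ((d + 2) * (k ^ (d + 1) * (2 ^ (4 * d + 3) * (4 * d + 4))))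
      * (16 * d + 14) + 3) ^ (k * d)) :
    (n : ℝ) ≤ 200 * ((k : ℝ) * (d : ℝ) ^ 2 * Real.log (k : ℝ)) := by
  -- For `d = 0` the exponent `k * d` vanishes, which forces `2 ^ n ≤ 1`.
  rcases Nat.eq_zero_or_pos d with rfl | hd
  · have : n = 0 := by
      by_contra hn
      have := Nat.one_lt_two_pow hn
      simp at h
      omega
    simp [this]
  rcases Nat.eq_zero_or_pos n with rfl | hn
  · have : 0 ≤ Real.log k := Real.log_natCast_nonneg k
    simp only [Nat.cast_zero]
    positivity
  have hpow : ∀ a, 2 ^ a ≤ k ^ a := fun a => Nat.pow_le_pow_left hk a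
  have hlt : ∀ a, a + 1 ≤ 2 ^ a := fun a => Nat.lt_two_pow_self
  have hbase : n * ((d + 2) * (k ^ (d + 1) * (2 ^ (4 * d + 3) * (4 * d + 4))))
      * (16 * d + 14) + 3 ≤ n * k ^ (20 * d) := by
    have h1 : d + 2 ≤ k ^ (d + 1) := (hlt (d + 1)).trans (hpow _)
    have h2 : 2 ^ (4 * d + 3) ≤ k ^ (4 * d + 3) := hpow _
    have h3 : 4 * d + 4 ≤ k ^ (d + 2) := by
      refine le_trans ?_ (hpow _)
      have := hlt d
      rw [pow_add]; omega
    have h4 : 16 * d + 17 ≤ k ^ (d + 5) := by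
      refine le_trans ?_ (hpow _)
      have := hlt d
      rw [pow_add]; omega
    set M := (d + 2) * (k ^ (d + 1) * (2 ^ (4 * d + 3) * (4 * d + 4))) with hM
    have hM0 : 0 < M := by positivity
    have hMle : M ≤ k ^ (d + 1) * (k ^ (d + 1) * (k ^ (4 * d + 3) * k ^ (d + 2))) := by
      rw [hM]; gcongr
    calc n * M * (16 * d + 14) + 3 ≤ n * M * (16 * d + 17) := by
          have : 1 ≤ n * M := Nat.mul_pos hn hM0
          nlinarith
      _ ≤ n * (k ^ (d + 1) * (k ^ (d + 1) * (k ^ (4 * d + 3) * k ^ (d + 2)))) * k ^ (d + 5) := by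
          gcongr
      _ = n * k ^ (8 * d + 12) := by ring
      -- Here `8 d + 12 ≤ 20 d` uses `d ≥ 1`.
      _ ≤ n * k ^ (20 * d) := by gcongr <;> omega
  have h2 : (2 : ℝ) ^ n ≤ ((n : ℝ) * (k : ℝ) ^ (20 * d)) ^ (k * d) := by
    exact_mod_cast h.trans (Nat.pow_le_pow_left hbase _)
  have hn0 : (0 : ℝ) < n := by exact_mod_cast hn
  have hk0 : (0 : ℝ) < k := by positivity
  have hd0 : (1 : ℝ) ≤ d := by exact_mod_cast hd
  have h3 := Real.log_le_log (by positivity) h2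
  rw [Real.log_pow, Real.log_pow, Real.log_mul hn0.ne' (by positivity), Real.log_pow] at h3
  push_cast at h3
  set A : ℝ := k * d with hA
  have hA0 : 0 < A := by positivity
  set l := Real.log k with hl
  have hl2 : Real.log 2 ≤ l := Real.log_le_log two_pos (by exact_mod_cast hk)
  have hlog2 : (1 : ℝ) / 2 ≤ Real.log 2 := by linarith [Real.log_two_gt_d9]
  have hlogd : Real.log d ≤ d * l := by
    have : (d : ℝ) ≤ (k : ℝ) ^ d := by exact_mod_cast ((hlt d).trans (hpow d)).trans' (by omega)
    have := Real.log_le_log (by positivity) this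
    rwa [Real.log_pow] at this
  have hlogA : Real.log A ≤ 2 * (d * l) := by
    rw [hA, Real.log_mul hk0.ne' (by positivity)]
    nlinarith
  -- `log (n / (4 A)) ≤ n / (4 A) - 1`
  have hlogn : Real.log n ≤ n / (4 * A) - 1 + (Real.log 4 + Real.log A) := by
    have h5 := Real.log_le_sub_one_of_pos (x := n / (4 * A)) (by positivity)
    rw [Real.log_div hn0.ne' (by positivity), Real.log_mul four_ne_zero hA0.ne'] at h5
    linarith
  have hlog4 : Real.log 4 = 2 * Real.log 2 := by
    rw [show (4 : ℝ) = 2 ^ 2 by norm_num, Real.log_pow]; norm_num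
  have hdl : l ≤ d * l := by nlinarith
  -- The coefficient is `24 = 20 + 2 + 2`, the last two terms coming from `log A` and `log 4`.
  have h6 : Real.log n + 20 * d * l ≤ n / (4 * A) + 24 * (d * l) := by linarith
  have h7 : A * (Real.log n + 20 * d * l) ≤ n / 4 + 24 * (A * (d * l)) := by
    calc A * (Real.log n + 20 * d * l) ≤ A * (n / (4 * A) + 24 * (d * l)) := by gcongr
      _ = n / 4 + 24 * (A * (d * l)) := by field_simp
  have h8 : (n : ℝ) * (1 / 2) ≤ n * Real.log 2 := by gcongr
  have h9 : (k : ℝ) * d ^ 2 * l = A * (d * l) := by rw [hA]; ring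
  have h10 : 0 ≤ A * (d * l) := by
    have : 0 ≤ l := by linarith
    positivity
  rw [h9]
  linarith

end StrategicClassification

end Hulls

theorem mainTheorem4 :
    ∃ C : ℝ, 0 < C ∧
      ∀ (d k : ℕ), 2 ≤ k →
      ∀ (p : ENNReal), p = 1 ∨ p = 2 ∨ p = ⊤ →
      ∀ (α : ℝ), 0 ≤ α →
      ∀ H : Set (Set (Fin d → ℝ)), H ⊆ StrategicClassification.vertexPolytopes d k →
        ∃ n : ℕ,
          StrategicClassification.classVCDim
            (StrategicClassification.effectiveClass α
              (StrategicClassification.lpCost p) H) = (n : ℕ∞) ∧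
          (n : ℝ) ≤ C * ((k : ℝ) * (d : ℝ) ^ 2 * Real.log (k : ℝ)) := by
  refine ⟨200, by norm_num, fun d k hk p hp α hα H hH => ?_⟩
  set B : ℝ := 200 * ((k : ℝ) * (d : ℝ) ^ 2 * Real.log (k : ℝ))
  have hB : 0 ≤ B := by
    have : 0 ≤ Real.log k := Real.log_natCast_nonneg k
    positivity
  have hle : StrategicClassification.classVCDim (StrategicClassification.effectiveClass α
      (StrategicClassification.lpCost p) H) ≤ (⌊B⌋₊ : ℕ∞) := by
    refine iSup₂_le fun S hS => ?_
    have := StrategicClassification.card_le_of_two_pow_le hk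
      (StrategicClassification.two_pow_card_le_of_classShatters (by omega) hp hα hH hS)
    exact Nat.cast_le.2 (Nat.le_floor this)
  obtain ⟨n, hn, hnB⟩ := ENat.le_natCast_iff.1 hle
  exact ⟨n, hn, (Nat.le_floor_iff hB).1 hnB⟩
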